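/- Let $D = \{z \in \mathbb{C} : |z| < 1\}$ be the unit disc and $D^* = D \setminus \{0\}$ the punctured unit disc. For an integer $k \ge 1$ let $$\mathbb{H}_k = \{(z_1, z_2) \in \mathbb{C}^2 : |z_1|^k < |z_2| < 1\}.$$ Then for every integer $k \ge 2$ the domain $\mathbb{H}_k$ is not biholomorphic to $D \times D^*$; that is, there is no holomorphic map $\mathbb{H}_k \to D \times D^*$ with a holomorphic two-sided inverse $D \times D^* \to \mathbb{H}_k$. -/

import Mathlib

/-- Two domains `U` and `V` (open subsets of complex normed spaces) are biholomorphic: there is a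
holomorphic map from `U` to `V` with a holomorphic two-sided inverse from `V` to `U`.
On open sets, holomorphic means complex differentiable at every point. -/
def Biholomorphic {E F : Type*} [NormedAddCommGroup E] [NormedSpace ℂ E]
    [NormedAddCommGroup F] [NormedSpace ℂ F] (U : Set E) (V : Set F) : Prop :=
  ∃ (f : E → F) (g : F → E),
    DifferentiableOn ℂ f U ∧ DifferentiableOn ℂ g V ∧
      Set.MapsTo f U V ∧ Set.MapsTo g V U ∧
      Set.LeftInvOn g f U ∧ Set.RightInvOn g f V

/-- The generalized Hartogs triangle of exponent `γ > 0`. -/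
def hartogsTriangle (γ : ℝ) : Set (ℂ × ℂ) :=
  {z | ‖z.1‖ ^ γ < ‖z.2‖ ∧ ‖z.2‖ < 1}

/-- The open unit disc in the complex plane. -/
def unitDisc : Set ℂ := {z | ‖z‖ < 1}

/-- The punctured open unit disc in the complex plane. -/
def puncturedDisc : Set ℂ := {z | 0 < ‖z‖ ∧ ‖z‖ < 1}

/-! Every holomorphic disc through the origin inside `ℍ_k` is pushed by `f` to a point of `D × {0}`.
For the disc `(w t, t ^ k)`, where `z₁ ^ k / z₂` is the constant `w ^ k`, let `(q, 0)` be that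
point. By `tendsto_slice_of_tendsto_comp`, `g` tends to the origin and `z₁ ^ k / z₂` to `w ^ k ≠ 0`
along `{q} × D*`. Schwarz on the axis plus a Harnack estimate bound the second component of `f` near
the axis; read through `g`, this forces `z₂ ∘ g` to vanish to order at most `7 / 5`, hence exactly
`1`, along that slice. As `z₁ ∘ g` vanishes too, `z₁ ^ k / z₂` has order at least `k - 1 > 0`: a
contradiction. -/

open Filter Topology Metric Set in
/-- A holomorphic map from the punctured disc to the disc extends holomorphically to the disc, and
the extension still maps into the (open) disc. -/
theorem exists_extension_of_puncturedDisc {h : ℂ → ℂ} (hd : DifferentiableOn ℂ h puncturedDisc)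
    (hb : ∀ t ∈ puncturedDisc, ‖h t‖ < 1) :
    ∃ H : ℂ → ℂ, DifferentiableOn ℂ H (ball 0 1) ∧ MapsTo H (ball 0 1) (ball 0 1) ∧
      EqOn H h puncturedDisc := by
  have hset : ball (0 : ℂ) 1 \ {0} = puncturedDisc := by
    ext t
    simp [puncturedDisc, and_comm]
  set H := Function.update h 0 (limUnder (𝓝[≠] 0) h) with hH
  have hHd : DifferentiableOn ℂ H (ball 0 1) := by
    refine Complex.differentiableOn_update_limUnder_of_bddAbove (ball_mem_nhds 0 one_pos)
      (hset ▸ hd) ⟨1, ?_⟩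
    rintro _ ⟨t, ht, rfl⟩
    exact (hb t (hset ▸ ht)).le
  have heq : EqOn H h puncturedDisc := fun t ht ↦ by
    have : t ≠ 0 := norm_pos_iff.mp ht.1
    simp [hH, this]
  have hball : ∀ t ∈ ball (0 : ℂ) 1, t ≠ 0 → ‖H t‖ < 1 := fun t ht h0 ↦ by
    have ht' : t ∈ puncturedDisc := hset ▸ ⟨ht, h0⟩
    rw [heq ht']
    exact hb t ht'
  refine ⟨H, hHd, fun t ht ↦ ?_, heq⟩
  rw [mem_ball_zero_iff]
  by_cases h0 : t = 0
  · subst h0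
    -- Otherwise the maximum principle makes `H` constant of norm at least one.
    by_contra! hge
    have hmax : IsMaxOn (norm ∘ H) (ball 0 1) 0 := fun s hs ↦ by
      by_cases hs0 : s = 0
      · simp [hs0]
      · exact (hball s hs hs0).le.trans hge
    have hconst := Complex.eqOn_of_isPreconnected_of_isMaxOn_norm
      (convex_ball (0 : ℂ) 1).isPreconnected isOpen_ball hHd ht hmax
    have hhalf : (1 / 2 : ℂ) ∈ ball (0 : ℂ) 1 := by
      rw [mem_ball_zero_iff]
      norm_num
    have h1 := hball _ hhalf (by norm_num)
    rw [hconst hhalf] at h1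
    exact absurd h1 (not_lt.mpr hge)
  · exact hball t ht h0

theorem puncturedDisc_mem_nhdsWithin : puncturedDisc ∈ nhdsWithin (0 : ℂ) {0}ᶜ := by
  filter_upwards [self_mem_nhdsWithin,
    mem_nhdsWithin_of_mem_nhds (Metric.ball_mem_nhds (0 : ℂ) one_pos)] with t h0 h1
  exact ⟨norm_pos_iff.mpr h0, mem_ball_zero_iff.mp h1⟩

open Filter Topology Metric Set in
theorem tendsto_of_eqOn_puncturedDisc {h H : ℂ → ℂ} (hH : DifferentiableOn ℂ H (ball 0 1))
    (heq : EqOn H h puncturedDisc) : Tendsto h (𝓝[≠] 0) (𝓝 (H 0)) := by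
  have hc : ContinuousAt H 0 := (hH.differentiableAt (ball_mem_nhds 0 one_pos)).continuousAt
  refine (hc.tendsto.mono_left nhdsWithin_le_nhds).congr' ?_
  filter_upwards [puncturedDisc_mem_nhdsWithin] with t ht using heq ht

open Metric Set in
/-- A Harnack type estimate for zero-free holomorphic functions on the disc bounded by one. -/
theorem norm_pow_seven_le_of_ne_zero {h : ℂ → ℂ} (hd : DifferentiableOn ℂ h (ball 0 1))
    (h0 : ∀ z ∈ ball (0 : ℂ) 1, h z ≠ 0) (hb : ∀ z ∈ ball (0 : ℂ) 1, ‖h z‖ < 1)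
    {z : ℂ} (hz : ‖z‖ ≤ 1 / 8) : ‖h z‖ ^ 7 ≤ ‖h 0‖ ^ 5 := by
  have m0 : (0 : ℂ) ∈ ball (0 : ℂ) 1 := mem_ball_self one_pos
  have mz : z ∈ ball (0 : ℂ) 1 := by rw [mem_ball_zero_iff]; linarith
  have hq : DifferentiableOn ℂ (fun w ↦ deriv h w / h w) (ball 0 1) :=
    (hd.deriv isOpen_ball).div hd h0
  -- A primitive of `h' / h`, normalized at `0`, is a logarithm of `h / h 0`.
  obtain ⟨L₀, hL₀⟩ := hq.isExactOn_ball
  set L : ℂ → ℂ := fun w ↦ L₀ w - L₀ 0 with hLdef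
  have hL : ∀ w ∈ ball (0 : ℂ) 1, HasDerivAt L (deriv h w / h w) w :=
    fun w hw ↦ (hL₀ w hw).sub_const _
  have hLd : DifferentiableOn ℂ L (ball 0 1) :=
    fun w hw ↦ (hL w hw).differentiableAt.differentiableWithinAt
  have hexp : ∀ w ∈ ball (0 : ℂ) 1, h w = h 0 * Complex.exp (L w) := by
    have hder : ∀ w ∈ ball (0 : ℂ) 1,
        HasDerivAt (fun w ↦ h w * Complex.exp (-L w)) 0 w := fun w hw ↦ by
      have h1 := (hd.differentiableAt (isOpen_ball.mem_nhds hw)).hasDerivAt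
      have h2 := h1.mul (hL w hw).neg.cexp
      refine h2.congr_deriv ?_
      have := h0 w hw
      field_simp
      ring
    intro w hw
    have hc : h w * Complex.exp (-L w) = h 0 * Complex.exp (-L 0) :=
      (convex_ball (0 : ℂ) 1).is_const_of_fderivWithin_eq_zero (𝕜 := ℂ)
        (fun w hw ↦ (hder w hw).differentiableAt.differentiableWithinAt)
        (fun w hw ↦ by
          rw [fderivWithin_of_isOpen isOpen_ball hw]
          ext
          simp [(hder w hw).deriv]) hw m0
    have hL0 : L 0 = 0 := by simp [hLdef]
    rw [hL0, neg_zero, Complex.exp_zero, mul_one] at hc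
    rw [← hc, mul_assoc, ← Complex.exp_add]
    simp
  have hnorm : ∀ w ∈ ball (0 : ℂ) 1, Real.log ‖h w‖ = Real.log ‖h 0‖ + (L w).re := fun w hw ↦ by
    conv_lhs => rw [hexp w hw]
    rw [norm_mul, Complex.norm_exp, Real.log_mul (norm_ne_zero_iff.mpr (h0 0 m0))
      (Real.exp_pos _).ne', Real.log_exp]
  have hlog : ∀ w ∈ ball (0 : ℂ) 1, Real.log ‖h w‖ < 0 := fun w hw ↦
    Real.log_neg (norm_pos_iff.mpr (h0 w hw)) (hb w hw)
  have hM : 0 < -Real.log ‖h 0‖ := neg_pos.mpr (hlog 0 m0)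
  have hBC := Complex.borelCaratheodory_zero hM hLd
    (fun w hw ↦ by
      have h1 := hlog w hw
      rw [hnorm w hw] at h1
      simp only [mem_ofPred_eq]
      linarith) one_pos mz (by simp [hLdef])
  -- With `M = -log ‖h 0‖`, Borel–Carathéodory gives `2 M ‖z‖ / (1 - ‖z‖)`, at most `2 M / 7` for
  -- `‖z‖ ≤ 1 / 8`; hence the exponents `7` and `5 = 7 - 2`.
  have hre : (L z).re ≤ 2 / 7 * (-Real.log ‖h 0‖) := by
    refine (Complex.re_le_norm _).trans (hBC.trans ?_)
    rw [div_le_iff₀ (by linarith)]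
    nlinarith
  have hfin : 7 * Real.log ‖h z‖ ≤ 5 * Real.log ‖h 0‖ := by
    rw [hnorm z mz]
    linarith
  have p0 := norm_pos_iff.mpr (h0 0 m0)
  have pz := norm_pos_iff.mpr (h0 z mz)
  rw [← Real.log_le_log_iff (by positivity) (by positivity), Real.log_pow, Real.log_pow]
  exact_mod_cast hfin

open Filter Topology Metric Set in
/-- Let `B` be holomorphic and bounded by one on the product of the disc and the punctured disc.
A limit of `B` along some curve tending to `(q, 0)` is also its limit along `{q} × D*`. -/
theorem tendsto_slice_of_tendsto_comp {B : ℂ × ℂ → ℂ}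
    (hB : DifferentiableOn ℂ B (unitDisc ×ˢ puncturedDisc))
    (hb : ∀ p ∈ unitDisc ×ˢ puncturedDisc, ‖B p‖ < 1)
    {γ : ℂ → ℂ × ℂ} {q b : ℂ} (hq : ‖q‖ < 1) (hγ : MapsTo γ puncturedDisc (unitDisc ×ˢ puncturedDisc))
    (hlim : Tendsto γ (𝓝[≠] 0) (𝓝 (q, 0))) (hBlim : Tendsto (fun t ↦ B (γ t)) (𝓝[≠] 0) (𝓝 b)) :
    Tendsto (fun τ ↦ B (q, τ)) (𝓝[≠] 0) (𝓝 b) := by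
  obtain ⟨H, hHd, -, hHeq⟩ := exists_extension_of_puncturedDisc (h := fun τ ↦ B (q, τ))
    (hB.comp (by fun_prop) fun τ hτ ↦ ⟨hq, hτ⟩) fun τ hτ ↦ hb _ ⟨hq, hτ⟩
  have hslice := tendsto_of_eqOn_puncturedDisc hHd hHeq
  have hfst : Tendsto (fun t ↦ (γ t).1) (𝓝[≠] 0) (𝓝 q) := (continuous_fst.tendsto _).comp hlim
  have hsnd : Tendsto (fun t ↦ (γ t).2) (𝓝[≠] 0) (𝓝[≠] 0) := by
    refine tendsto_nhdsWithin_iff.mpr ⟨(continuous_snd.tendsto _).comp hlim, ?_⟩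
    filter_upwards [puncturedDisc_mem_nhdsWithin] with t ht
    exact norm_pos_iff.mp (hγ ht).2.1
  have hr : 0 < 1 - ‖q‖ := by linarith
  -- By Schwarz, `B` is Lipschitz in its first variable near `q`, uniformly in the second.
  have hdist : Tendsto (fun t ↦ dist (B (γ t)) (B (q, (γ t).2))) (𝓝[≠] 0) (𝓝 0) := by
    have hup : Tendsto (fun t ↦ 2 / (1 - ‖q‖) * dist (γ t).1 q) (𝓝[≠] 0) (𝓝 0) := by
      simpa using (hfst.dist (tendsto_const_nhds (x := q))).const_mul (2 / (1 - ‖q‖))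
    refine squeeze_zero' (Eventually.of_forall fun _ ↦ dist_nonneg) ?_ hup
    filter_upwards [puncturedDisc_mem_nhdsWithin, hfst (ball_mem_nhds q hr)] with t ht htq
    have hsub : ∀ x ∈ ball q (1 - ‖q‖), (x, (γ t).2) ∈ unitDisc ×ˢ puncturedDisc := fun x hx ↦ by
      refine ⟨?_, (hγ ht).2⟩
      rw [mem_ball, dist_eq_norm] at hx
      have := norm_le_norm_add_norm_sub' x q
      change ‖x‖ < 1
      linarith
    refine Complex.dist_le_div_mul_dist_of_mapsTo_ball (f := fun x ↦ B (x, (γ t).2)) (c := q)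
      (z := (γ t).1) (hB.comp (by fun_prop) hsub) (fun x hx ↦ ?_) htq
    rw [mem_closedBall, dist_eq_norm]
    have h1 := hb _ (hsub x hx)
    have h2 := hb _ (hsub q (mem_ball_self hr))
    have := norm_sub_le (B (x, (γ t).2)) (B (q, (γ t).2))
    linarith
  have hb' : Tendsto (fun t ↦ B (q, (γ t).2)) (𝓝[≠] 0) (𝓝 b) :=
    hBlim.congr_dist hdist
  rwa [← tendsto_nhds_unique (hslice.comp hsnd) hb']

theorem mem_hartogsTriangle_natCast {k : ℕ} {z : ℂ × ℂ} :
    z ∈ hartogsTriangle (k : ℝ) ↔ ‖z.1‖ ^ k < ‖z.2‖ ∧ ‖z.2‖ < 1 := by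
  simp [hartogsTriangle, Real.rpow_natCast]

theorem axis_mapsTo_hartogsTriangle {k : ℕ} (hk : k ≠ 0) :
    Set.MapsTo (fun s : ℂ ↦ ((0 : ℂ), s)) puncturedDisc (hartogsTriangle (k : ℝ)) := fun s hs ↦ by
  rw [mem_hartogsTriangle_natCast]
  simpa [hk, puncturedDisc] using hs

open Filter Topology Metric Set in
/-- Under a biholomorphic map to `D × D*`, a punctured holomorphic disc in the Hartogs triangle
tending to the origin tends to a point of `D × {0}`. -/
theorem exists_tendsto_comp_of_tendsto_zero {k : ℕ} (hk : k ≠ 0) {f g : ℂ × ℂ → ℂ × ℂ}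
    (hf : DifferentiableOn ℂ f (hartogsTriangle (k : ℝ)))
    (hg : DifferentiableOn ℂ g (unitDisc ×ˢ puncturedDisc))
    (hfm : MapsTo f (hartogsTriangle (k : ℝ)) (unitDisc ×ˢ puncturedDisc))
    (hgm : MapsTo g (unitDisc ×ˢ puncturedDisc) (hartogsTriangle (k : ℝ)))
    (hgf : LeftInvOn g f (hartogsTriangle (k : ℝ)))
    {γ : ℂ → ℂ × ℂ} (hγ : DifferentiableOn ℂ γ puncturedDisc)
    (hγm : MapsTo γ puncturedDisc (hartogsTriangle (k : ℝ)))
    (hlim : Tendsto γ (𝓝[≠] 0) (𝓝 0)) :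
    ∃ q : ℂ, ‖q‖ < 1 ∧ Tendsto (fun t ↦ f (γ t)) (𝓝[≠] 0) (𝓝 (q, 0)) := by
  have hfγ : DifferentiableOn ℂ (fun t ↦ f (γ t)) puncturedDisc := hf.comp hγ hγm
  obtain ⟨H₁, hd₁, hm₁, he₁⟩ := exists_extension_of_puncturedDisc (h := fun t ↦ (f (γ t)).1)
    hfγ.fst fun t ht ↦ (hfm (hγm ht)).1
  obtain ⟨H₂, hd₂, hm₂, he₂⟩ := exists_extension_of_puncturedDisc (h := fun t ↦ (f (γ t)).2)
    hfγ.snd fun t ht ↦ (hfm (hγm ht)).2.2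
  have m0 : (0 : ℂ) ∈ ball (0 : ℂ) 1 := mem_ball_self one_pos
  have hq₁ : ‖H₁ 0‖ < 1 := mem_ball_zero_iff.mp (hm₁ m0)
  have hq₂ : ‖H₂ 0‖ < 1 := mem_ball_zero_iff.mp (hm₂ m0)
  have ht : Tendsto (fun t ↦ f (γ t)) (𝓝[≠] 0) (𝓝 (H₁ 0, H₂ 0)) :=
    (tendsto_of_eqOn_puncturedDisc hd₁ he₁).prodMk_nhds (tendsto_of_eqOn_puncturedDisc hd₂ he₂)
  have hzero : H₂ 0 = 0 := by
    -- A limit inside `D × D*` would be carried by `g` into the Hartogs triangle, which omits the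
    -- origin.
    by_contra hne
    have hp : (H₁ 0, H₂ 0) ∈ unitDisc ×ˢ puncturedDisc := ⟨hq₁, norm_pos_iff.mpr hne, hq₂⟩
    have hw : Tendsto (fun t ↦ f (γ t)) (𝓝[≠] 0) (𝓝[unitDisc ×ˢ puncturedDisc] (H₁ 0, H₂ 0)) := by
      refine tendsto_nhdsWithin_iff.mpr ⟨ht, ?_⟩
      filter_upwards [puncturedDisc_mem_nhdsWithin] with t ht using hfm (hγm ht)
    have hg' : Tendsto γ (𝓝[≠] 0) (𝓝 (g (H₁ 0, H₂ 0))) := by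
      refine ((hg.continuousOn _ hp).tendsto.comp hw).congr' ?_
      filter_upwards [puncturedDisc_mem_nhdsWithin] with t ht using hgf (hγm ht)
    have hmem := hgm hp
    rw [tendsto_nhds_unique hg' hlim, mem_hartogsTriangle_natCast] at hmem
    simp [hk] at hmem
  rw [hzero] at ht
  exact ⟨H₁ 0, hq₁, ht⟩

open Filter Topology Metric Set in
/-- A zero-free holomorphic function on the Hartogs triangle, bounded by one and tending to `0`
along the axis `{0} × D*`, is small near that axis. -/
theorem norm_pow_seven_le_norm_snd_pow_five {k : ℕ} (hk : k ≠ 0) {u : ℂ × ℂ → ℂ}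
    (hu : DifferentiableOn ℂ u (hartogsTriangle (k : ℝ)))
    (hum : MapsTo u (hartogsTriangle (k : ℝ)) puncturedDisc)
    (hlim : Tendsto (fun s : ℂ ↦ u (0, s)) (𝓝[≠] 0) (𝓝 0))
    {z : ℂ × ℂ} (hz : z ∈ hartogsTriangle (k : ℝ)) (hsmall : ‖z.1‖ ^ k ≤ (1 / 8) ^ k * ‖z.2‖) :
    ‖u z‖ ^ 7 ≤ ‖z.2‖ ^ 5 := by
  obtain ⟨z₁, s⟩ := z
  obtain ⟨hz₁, hs1⟩ := mem_hartogsTriangle_natCast.mp hz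
  simp only at hz₁ hs1 hsmall ⊢
  have hs0 : 0 < ‖s‖ := (by positivity : 0 ≤ ‖z₁‖ ^ k).trans_lt hz₁
  have haxis := axis_mapsTo_hartogsTriangle hk
  have hschwarz : ‖u (0, s)‖ ≤ ‖s‖ := by
    obtain ⟨H, hHd, hHm, hHeq⟩ := exists_extension_of_puncturedDisc (h := fun s ↦ u (0, s))
      (hu.comp (by fun_prop) haxis) fun s hs ↦ (hum (haxis hs)).2
    have hH0 : H 0 = 0 := tendsto_nhds_unique (tendsto_of_eqOn_puncturedDisc hHd hHeq) hlim
    have := Complex.norm_le_norm_of_mapsTo_ball hHd (hHm.mono_right ball_subset_closedBall) hH0 hs1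
    rwa [hHeq (show s ∈ puncturedDisc from ⟨hs0, hs1⟩)] at this
  -- The fibre over `s` is the disc of radius `ρ = ‖s‖ ^ (1 / k)`, and the Harnack estimate is
  -- applied to its rescaling.
  obtain ⟨ρ, hρ, hρk⟩ : ∃ ρ : ℝ, 0 < ρ ∧ ρ ^ k = ‖s‖ :=
    ⟨‖s‖ ^ ((k : ℝ)⁻¹), by positivity, Real.rpow_inv_natCast_pow hs0.le hk⟩
  have hmaps : ∀ w ∈ ball (0 : ℂ) 1, (w * ρ, s) ∈ hartogsTriangle (k : ℝ) := fun w hw ↦ by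
    rw [mem_hartogsTriangle_natCast]
    refine ⟨?_, hs1⟩
    rw [norm_mul, mul_pow, Complex.norm_real, Real.norm_of_nonneg hρ.le, hρk]
    have := pow_lt_one₀ (norm_nonneg w) (mem_ball_zero_iff.mp hw) hk
    nlinarith
  have hzρ : ‖z₁ / ρ‖ ≤ 1 / 8 := by
    rw [← hρk, ← mul_pow] at hsmall
    rw [norm_div, Complex.norm_real, Real.norm_of_nonneg hρ.le, div_le_iff₀ hρ]
    exact le_of_pow_le_pow_left₀ hk (by positivity) hsmall
  have hharnack := norm_pow_seven_le_of_ne_zero (h := fun w ↦ u (w * ρ, s))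
    (hu.comp (by fun_prop) hmaps) (fun w hw ↦ norm_pos_iff.mp (hum (hmaps w hw)).1)
    (fun w hw ↦ (hum (hmaps w hw)).2) hzρ
  have hρ0 : (ρ : ℂ) ≠ 0 := by exact_mod_cast hρ.ne'
  simp only [div_mul_cancel₀ _ hρ0, zero_mul] at hharnack
  exact hharnack.trans (by gcongr)

open Filter Topology Metric Set in
theorem mainTheorem5 (k : ℕ) (hk : 2 ≤ k) :
    ¬ Biholomorphic (hartogsTriangle (k : ℝ)) (unitDisc ×ˢ puncturedDisc) := by
  rintro ⟨f, g, hf, hg, hfm, hgm, hgf, hfg⟩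
  have hk0 : k ≠ 0 := by omega
  have hsnd : ∀ p ∈ unitDisc ×ˢ puncturedDisc, 0 < ‖(g p).2‖ := fun p hp ↦
    (by positivity : 0 ≤ ‖(g p).1‖ ^ k).trans_lt (mem_hartogsTriangle_natCast.mp (hgm hp)).1
  have haxis : Tendsto (fun s : ℂ ↦ (f (0, s)).2) (𝓝[≠] 0) (𝓝 0) := by
    obtain ⟨q, -, hq⟩ := exists_tendsto_comp_of_tendsto_zero hk0 hf hg hfm hgm hgf
      (γ := fun s ↦ (0, s)) (by fun_prop)
      (axis_mapsTo_hartogsTriangle hk0)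
      (tendsto_nhdsWithin_of_tendsto_nhds (Continuous.tendsto' (by fun_prop) _ _ rfl))
    exact (continuous_snd.tendsto _).comp hq
  -- Any nonzero `w` with `‖w‖ < 1 / 8` works: strictness keeps the slice near `0` in the Harnack
  -- region.
  set w : ℂ := 1 / 16 with hw
  have hwn : ‖w‖ = 1 / 16 := by simp [hw]
  set γ : ℂ → ℂ × ℂ := fun t ↦ (w * t, t ^ k) with hγdef
  have hγm : MapsTo γ puncturedDisc (hartogsTriangle (k : ℝ)) := fun t ht ↦ by
    rw [mem_hartogsTriangle_natCast]
    simp only [hγdef, norm_mul, norm_pow, mul_pow, hwn]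
    have h1 : (1 / 16 : ℝ) ^ k < 1 := pow_lt_one₀ (by norm_num) (by norm_num) hk0
    have h2 : 0 < ‖t‖ ^ k := pow_pos ht.1 k
    exact ⟨by nlinarith, pow_lt_one₀ ht.1.le ht.2 hk0⟩
  have hγ0 : Tendsto γ (𝓝[≠] 0) (𝓝 0) :=
    tendsto_nhdsWithin_of_tendsto_nhds (Continuous.tendsto' (by fun_prop) _ _ (by simp [hγdef, hk0]))
  obtain ⟨q, hq, hqlim⟩ := exists_tendsto_comp_of_tendsto_zero hk0 hf hg hfm hgm hgf
    (γ := γ) (by fun_prop) hγm hγ0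
  have hfγm : MapsTo (fun t ↦ f (γ t)) puncturedDisc (unitDisc ×ˢ puncturedDisc) := hfm.comp hγm
  have hgfγ : ∀ᶠ t in 𝓝[≠] 0, γ t = g (f (γ t)) := by
    filter_upwards [puncturedDisc_mem_nhdsWithin] with t ht using (hgf (hγm ht)).symm
  have hb₁ : ∀ p ∈ unitDisc ×ˢ puncturedDisc, ‖(g p).1‖ < 1 := fun p hp ↦ by
    have := mem_hartogsTriangle_natCast.mp (hgm hp)
    exact (pow_lt_one_iff_of_nonneg (norm_nonneg _) hk0).mp (this.1.trans this.2)
  have hb₂ : ∀ p ∈ unitDisc ×ˢ puncturedDisc, ‖(g p).2‖ < 1 := fun p hp ↦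
    (mem_hartogsTriangle_natCast.mp (hgm hp)).2
  -- the limits of the coordinates of `g` and of `z₁ ^ k / z₂` along `{q} × D*`
  have hG₁ : Tendsto (fun τ ↦ (g (q, τ)).1) (𝓝[≠] 0) (𝓝 0) :=
    tendsto_slice_of_tendsto_comp (B := fun p ↦ (g p).1) hg.fst hb₁ hq hfγm hqlim
      (((continuous_fst.tendsto _).comp hγ0).congr' (hgfγ.mono fun t ht ↦ congrArg Prod.fst ht))
  have hG₂ : Tendsto (fun τ ↦ (g (q, τ)).2) (𝓝[≠] 0) (𝓝 0) :=
    tendsto_slice_of_tendsto_comp (B := fun p ↦ (g p).2) hg.snd hb₂ hq hfγm hqlim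
      (((continuous_snd.tendsto _).comp hγ0).congr' (hgfγ.mono fun t ht ↦ congrArg Prod.snd ht))
  have hA : Tendsto (fun τ ↦ (g (q, τ)).1 ^ k / (g (q, τ)).2) (𝓝[≠] 0) (𝓝 (w ^ k)) := by
    refine tendsto_slice_of_tendsto_comp (B := fun p ↦ (g p).1 ^ k / (g p).2) ?_ (fun p hp ↦ ?_)
      hq hfγm hqlim (tendsto_const_nhds.congr' ?_)
    · simp only [div_eq_mul_inv]
      exact (hg.fst.pow k).mul (hg.snd.inv fun p hp ↦ norm_pos_iff.mp (hsnd p hp))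
    · rw [norm_div, norm_pow, div_lt_one (hsnd p hp)]
      exact (mem_hartogsTriangle_natCast.mp (hgm hp)).1
    · filter_upwards [hgfγ, self_mem_nhdsWithin] with t ht h0
      have h0' : t ^ k ≠ 0 := pow_ne_zero k h0
      rw [← ht]
      simp only [hγdef]
      rw [mul_pow, mul_div_cancel_right₀ _ h0']
  have hslice : ∀ τ ∈ puncturedDisc, (q, τ) ∈ unitDisc ×ˢ puncturedDisc := fun τ hτ ↦ ⟨hq, hτ⟩
  have hgq : DifferentiableOn ℂ (fun τ ↦ g (q, τ)) puncturedDisc := hg.comp (by fun_prop) hslice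
  obtain ⟨H₁, hd₁, hm₁, he₁⟩ := exists_extension_of_puncturedDisc (h := fun τ ↦ (g (q, τ)).1)
    hgq.fst fun τ hτ ↦ hb₁ _ (hslice τ hτ)
  obtain ⟨H₂, hd₂, hm₂, he₂⟩ := exists_extension_of_puncturedDisc (h := fun τ ↦ (g (q, τ)).2)
    hgq.snd fun τ hτ ↦ hb₂ _ (hslice τ hτ)
  have hH₁0 : H₁ 0 = 0 := tendsto_nhds_unique (tendsto_of_eqOn_puncturedDisc hd₁ he₁) hG₁
  have hH₂0 : H₂ 0 = 0 := tendsto_nhds_unique (tendsto_of_eqOn_puncturedDisc hd₂ he₂) hG₂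
  have hest : ∀ᶠ τ in 𝓝[≠] (0 : ℂ), ‖τ‖ ^ 7 ≤ ‖H₂ τ‖ ^ 5 := by
    have hlt : ‖w ^ k‖ < (1 / 8 : ℝ) ^ k := by
      rw [norm_pow, hwn]
      exact pow_lt_pow_left₀ (by norm_num) (by norm_num) hk0
    filter_upwards [puncturedDisc_mem_nhdsWithin, hA.norm.eventually_lt_const hlt] with τ hτ hτA
    have hp := hslice τ hτ
    have h1 := norm_pow_seven_le_norm_snd_pow_five hk0 hf.snd (fun z hz ↦ (hfm hz).2) haxis
      (hgm hp) (by
        rw [norm_div, norm_pow, div_lt_iff₀ (hsnd _ hp)] at hτA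
        exact hτA.le)
    rw [he₂ hτ]
    rwa [hfg hp] at h1
  have hderiv : HasDerivAt H₂ (deriv H₂ 0) 0 :=
    (hd₂.differentiableAt (ball_mem_nhds 0 one_pos)).hasDerivAt
  -- A double zero would give `‖H₂ τ‖ ≤ ‖τ‖ ^ 2`, so `‖τ‖ ^ 7 ≤ ‖τ‖ ^ 10`; this is where `7 / 5 < 2`
  -- matters.
  have hne : deriv H₂ 0 ≠ 0 := by
    intro h0
    have hlo : (H₂ · - H₂ 0) =o[𝓝 0] (fun τ ↦ ‖τ - 0‖ ^ 1) := by
      rw [h0, hasDerivAt_iff_isLittleO] at hderiv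
      simpa using hderiv.norm_right
    have hsq : ∀ τ ∈ ball (0 : ℂ) 1, ‖H₂ τ‖ ≤ ‖τ‖ ^ 2 := fun τ hτ ↦ by
      have := Complex.dist_le_mul_div_pow_of_mapsTo_ball_of_isLittleO hd₂
        (R₂ := 1) (by rw [hH₂0]; exact hm₂.mono_right ball_subset_closedBall) hlo hτ
      simpa [hH₂0] using this
    obtain ⟨τ, hτ7, hτ⟩ :=
      (hest.and (eventually_mem_set.mpr puncturedDisc_mem_nhdsWithin)).exists
    have h1 : ‖τ‖ ^ 7 ≤ (‖τ‖ ^ 2) ^ 5 :=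
      hτ7.trans (by gcongr; exact hsq τ (mem_ball_zero_iff.mpr hτ.2))
    rw [← pow_mul] at h1
    exact absurd h1 (not_le.mpr (pow_lt_pow_right_of_lt_one₀ hτ.1 hτ.2 (by norm_num)))
  have hslope : Tendsto (fun τ ↦ H₂ τ / τ) (𝓝[≠] 0) (𝓝 (deriv H₂ 0)) := by
    refine (hasDerivAt_iff_tendsto_slope.mp hderiv).congr fun τ ↦ ?_
    simp [slope, hH₂0, div_eq_inv_mul]
  have hA0 : Tendsto (fun τ ↦ (g (q, τ)).1 ^ k / (g (q, τ)).2) (𝓝[≠] 0) (𝓝 0) := by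
    -- Schwarz for `H₁` bounds the quotient by this function, which tends to `0` because `k ≥ 2`.
    have hup : Tendsto (fun τ : ℂ ↦ ‖τ‖ ^ (k - 1) / ‖H₂ τ / τ‖) (𝓝[≠] 0) (𝓝 0) := by
      have h1 : Tendsto (fun τ : ℂ ↦ ‖τ‖ ^ (k - 1)) (𝓝[≠] 0) (𝓝 0) :=
        tendsto_nhdsWithin_of_tendsto_nhds
          (Continuous.tendsto' (by fun_prop) _ _ (by simp; omega))
      have h2 := h1.div hslope.norm (norm_ne_zero_iff.mpr hne)
      rwa [zero_div] at h2
    refine squeeze_zero_norm' ?_ hup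
    filter_upwards [puncturedDisc_mem_nhdsWithin] with τ hτ
    have hτ0 := hτ.1
    have h2 : 0 < ‖H₂ τ‖ := by rw [he₂ hτ]; exact hsnd _ (hslice τ hτ)
    have h1 : ‖H₁ τ‖ ≤ ‖τ‖ := Complex.norm_le_norm_of_mapsTo_ball hd₁
      (hm₁.mono_right ball_subset_closedBall) hH₁0 hτ.2
    have e₁ := he₁ hτ
    have e₂ := he₂ hτ
    simp only at e₁ e₂
    rw [← e₁, ← e₂, norm_div, norm_pow, norm_div, div_div_eq_mul_div, ← pow_succ,
      Nat.sub_add_cancel (by omega)]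
    gcongr
  have := tendsto_nhds_unique hA hA0
  exact pow_ne_zero k (by simp [hw]) this
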